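/- Let $K$ be a field of characteristic zero and let $L\colon K[y]\to K[y]$ be a $K$-linear map with $\deg L(y^n)\le n+1$ for all $n\ge 0$. Let $L$ act on $K[y][[x]]$ coefficientwise in $x$, and let $G=G(x,y)\in K[y][[x]]$ be a solution of the functional equation $$G(x,y)=x\,L\!\left(\frac{1}{1-G(x,y)}\right).$$ Write $g_1(x)=[y^1]G(x,y)\in K[[x]]$. Let $\Delta\colon K[y]\to K[y]\otimes K[y]$ be the coproduct of the binomial coalgebra, $\Delta(y^n)=\sum_{k=0}^n\binom nk y^k\otimes y^{n-k}$, and call $L$ a binomial 1-cocycle if $\Delta\circ L=(\mathrm{id}\otimes L)\circ\Delta+L\otimes 1$, where $L\otimes 1$ denotes the map $p\mapsto L(p)\otimes 1$. Consider the renormalization group equation $$\frac{\partial}{\partial y}G(x,y)=g_1(x)\left(1+\Big(2x\frac{\partial}{\partial x}-1\Big)G(x,y)\right).\qquad(\ast)$$ (a) If $L$ is a binomial 1-cocycle, then $G$ satisfies $(\ast)$. (b) If $[y^1]L(1)\neq 0$, then $G$ satisfies $(\ast)$ if and only if $L$ is a binomial 1-cocycle. -/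

import Mathlib

open Polynomial PowerSeries
open scoped TensorProduct

/-- The coproduct of the binomial coalgebra on `K[y]`: the linear map with
`Δ(y ^ n) = ∑ k ≤ n, (n choose k) y ^ k ⊗ y ^ (n - k)`. -/
noncomputable def binomialComul (K : Type*) [Field K] : K[X] →ₗ[K] K[X] ⊗[K] K[X] :=
  Polynomial.lsum fun n => LinearMap.toSpanSingleton K (K[X] ⊗[K] K[X])
    (∑ k ∈ Finset.range (n + 1),
      (n.choose k : K) • ((Polynomial.X ^ k : K[X]) ⊗ₜ[K] (Polynomial.X ^ (n - k) : K[X])))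

theorem binomialComul_X_pow (K : Type*) [Field K] (n : ℕ) :
    binomialComul K (Polynomial.X ^ n) =
      ∑ k ∈ Finset.range (n + 1),
        (n.choose k : K) • ((Polynomial.X ^ k : K[X]) ⊗ₜ[K] (Polynomial.X ^ (n - k) : K[X])) := by
  rw [binomialComul, Polynomial.lsum_apply, ← Polynomial.monomial_one_right_eq_X_pow,
    Polynomial.sum_monomial_index _ _ (by simp)]
  simp

/-- `L` is a (Hochschild) 1-cocycle of the binomial coalgebra on `K[y]`:
`Δ ∘ L = (id ⊗ L) ∘ Δ + L ⊗ 1`, where `L ⊗ 1` is the map `p ↦ L p ⊗ 1`. -/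
def IsBinomialOneCocycle {K : Type*} [Field K] (L : K[X] →ₗ[K] K[X]) : Prop :=
  binomialComul K ∘ₗ L =
    LinearMap.lTensor K[X] L ∘ₗ binomialComul K +
      (TensorProduct.mk K K[X] K[X]).flip 1 ∘ₗ L

/-- A `K`-linear map on `K[y]`, acting coefficient by coefficient on `K[y][[x]]`. -/
noncomputable def mapCoeff {K : Type*} [Field K] (L : K[X] →ₗ[K] K[X]) (A : K[X]⟦X⟧) :
    K[X]⟦X⟧ :=
  PowerSeries.mk fun n => L (PowerSeries.coeff n A)

/-- `G ∈ K[y][[x]]` solves `G = x L(1 / (1 - G))`; here `P` is the inverse `1 / (1 - G)`. -/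
def IsTreeLikeSolution {K : Type*} [Field K] (L : K[X] →ₗ[K] K[X]) (G : K[X]⟦X⟧) : Prop :=
  ∃ P : K[X]⟦X⟧, (1 - G) * P = 1 ∧ G = PowerSeries.X * mapCoeff L P

/-- `g_i(x) = i! [y ^ i] G(x, y)`. -/
noncomputable def yCoeff {K : Type*} [Field K] (i : ℕ) (G : K[X]⟦X⟧) : K⟦X⟧ :=
  PowerSeries.mk fun n => (i.factorial : K) * (PowerSeries.coeff n G).coeff i

/-- The renormalization group equation
`∂G/∂y = g_1(x) (1 + (2 x ∂/∂x - 1) G)`, an identity in `K[y][[x]]`.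
Equivalently `∂H/∂y = g_1(x) (2 x ∂/∂x - 1) H` for `H = 1 - G`, with the same `g_1`, that of `G`. -/
def SatisfiesRGE {K : Type*} [Field K] (G : K[X]⟦X⟧) : Prop :=
  mapCoeff Polynomial.derivative G =
    PowerSeries.map Polynomial.C (yCoeff 1 G) *
      (1 + (2 * PowerSeries.X * PowerSeries.derivative K[X] G - G))

/-!
Write `D = d/dy` and `P = 1 / (1 - G)`, and consider the linear operator
`T f = D (L f) - L (D f) - [y¹](L f)` on `K[y]` (`cocycleDefect`).

*The cocycle condition says `T = 0`* (`isBinomialOneCocycle_iff`). In characteristic zero the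
coproduct is Taylor expansion, `Δ f = ∑ₖ yᵏ ⊗ Dᵏ f / k!`, so comparing the factors of `yᵏ` turns the
cocycle condition into `Dᵏ (L f) / k! = L (Dᵏ f / k!) + [yᵏ](L f)` for all `k`. The case `k = 1` is
`T f = 0`. Conversely, the constant coefficient of `T f = 0` reads `[y⁰] L (D f) = 0`, which is the
case `k = 0` since `D` is surjective, and the higher cases follow by induction on `k`.

*The renormalization group equation says that `T` kills the coefficients of `P`.* Let `V` be the
difference of its two sides. A direct computation from `G = x L(P)` gives
`x T(P) = V - x L(P² V)` (`X_mul_mapCoeff_cocycleDefect`). If `T = 0`, this determines the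
`x`-coefficients of `V` recursively, and they all vanish. If `V = 0`, then `T` vanishes on every
`x`-coefficient `pₙ` of `P`.

*The `pₙ` span `K[y]` when `[y¹] L(1) ≠ 0`.* For `V = 0` the equation, rewritten for `P`, becomes
`D P = g₁ (P + 2 x ∂P/∂x)`. Since `g₁` starts with `[y¹] L(1) x`, comparing top coefficients gives
`n [yⁿ] pₙ = (2 n - 1) [y¹] L(1) [yⁿ⁻¹] pₙ₋₁`, so `pₙ` has degree exactly `n`
(`coeff_of_derivative_eq`).
-/

/-! ### Coefficientwise action of linear maps -/

section Derivative

-- A general coefficient ring `R` is used because `K[X]⟦X⟧` carries two different `K[X]`-algebra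
-- structures: through the coefficients, and by evaluating polynomials at the power series variable.
variable {R : Type*} [CommRing R]

theorem powerSeriesDerivative_mul (A B : R⟦X⟧) :
    PowerSeries.derivative R (A * B) =
      A * PowerSeries.derivative R B + B * PowerSeries.derivative R A :=
  (PowerSeries.derivative R).leibniz A B

theorem powerSeriesDerivative_inverse {G P : R⟦X⟧} (hP : (1 - G) * P = 1) :
    PowerSeries.derivative R P = P ^ 2 * PowerSeries.derivative R G := by
  have h := congrArg (PowerSeries.derivative R) hP
  rw [powerSeriesDerivative_mul, map_sub, PowerSeries.derivative_one] at h
  linear_combination P * h - PowerSeries.derivative R P * hP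

end Derivative

section MapCoeff

variable {K : Type*} [Field K]

@[simp]
theorem coeff_mapCoeff (L : K[X] →ₗ[K] K[X]) (A : K[X]⟦X⟧) (n : ℕ) :
    PowerSeries.coeff n (mapCoeff L A) = L (PowerSeries.coeff n A) := by
  simp [mapCoeff]

theorem mapCoeff_add (L : K[X] →ₗ[K] K[X]) (A B : K[X]⟦X⟧) :
    mapCoeff L (A + B) = mapCoeff L A + mapCoeff L B := by
  ext1 n; simp

theorem mapCoeff_sub (L : K[X] →ₗ[K] K[X]) (A B : K[X]⟦X⟧) :
    mapCoeff L (A - B) = mapCoeff L A - mapCoeff L B := by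
  ext1 n; simp

/-- The coefficientwise action of `L` is linear over `K⟦x⟧`. -/
theorem mapCoeff_map_C_mul (L : K[X] →ₗ[K] K[X]) (g : K⟦X⟧) (A : K[X]⟦X⟧) :
    mapCoeff L (PowerSeries.map Polynomial.C g * A) =
      PowerSeries.map Polynomial.C g * mapCoeff L A := by
  ext1 n
  simp only [coeff_mapCoeff, PowerSeries.coeff_mul, PowerSeries.coeff_map, map_sum,
    ← Polynomial.smul_eq_C_mul, map_smul]

theorem mapCoeff_X_mul (L : K[X] →ₗ[K] K[X]) (A : K[X]⟦X⟧) :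
    mapCoeff L (PowerSeries.X * A) = PowerSeries.X * mapCoeff L A := by
  simpa using mapCoeff_map_C_mul L PowerSeries.X A

/-- The coefficientwise action of `L` commutes with `∂/∂x`. -/
theorem mapCoeff_derivative (L : K[X] →ₗ[K] K[X]) (A : K[X]⟦X⟧) :
    mapCoeff L (PowerSeries.derivative K[X] A) = PowerSeries.derivative K[X] (mapCoeff L A) := by
  ext1 n
  have h (p : K[X]) : p * ((n : K[X]) + 1) = ((n : K) + 1) • p := by
    simp [Polynomial.smul_eq_C_mul, mul_comm]
  simp only [coeff_mapCoeff, PowerSeries.coeff_derivative, h, map_smul]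

/-- The Leibniz rule for `∂/∂y`. -/
theorem mapCoeff_polynomialDerivative_mul (A B : K[X]⟦X⟧) :
    mapCoeff Polynomial.derivative (A * B) =
      mapCoeff Polynomial.derivative A * B + A * mapCoeff Polynomial.derivative B := by
  ext1 n
  simp [PowerSeries.coeff_mul, Finset.sum_add_distrib]

theorem mapCoeff_polynomialDerivative_inverse {G P : K[X]⟦X⟧} (hP : (1 - G) * P = 1) :
    mapCoeff Polynomial.derivative P = P ^ 2 * mapCoeff Polynomial.derivative G := by
  have h := mapCoeff_polynomialDerivative_mul (1 - G) P
  have h1 : mapCoeff Polynomial.derivative (1 : K[X]⟦X⟧) = 0 := by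
    ext1 n
    simp only [coeff_mapCoeff, PowerSeries.coeff_one]
    split_ifs <;> simp
  rw [hP, mapCoeff_sub, h1] at h
  linear_combination (-P) * h - mapCoeff Polynomial.derivative P * hP

end MapCoeff

/-! ### The cocycle condition as a commutation relation -/

section Cocycle

variable {K : Type*} [Field K]

/-- The operator `f ↦ D (L f) - L (D f) - [y¹](L f)`, where `D` is the derivative and the last term
is a constant polynomial. -/
noncomputable def cocycleDefect (L : K[X] →ₗ[K] K[X]) : K[X] →ₗ[K] K[X] :=
  Polynomial.derivative ∘ₗ L - L ∘ₗ Polynomial.derivative -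
    Polynomial.monomial 0 ∘ₗ Polynomial.lcoeff K 1 ∘ₗ L

theorem cocycleDefect_apply (L : K[X] →ₗ[K] K[X]) (f : K[X]) :
    cocycleDefect L f = Polynomial.derivative (L f) - L (Polynomial.derivative f) -
      Polynomial.C ((L f).coeff 1) := by
  simp [cocycleDefect]

/-- The coproduct is Taylor expansion; any truncation order above the degree gives the same sum. -/
theorem binomialComul_eq_sum_hasseDeriv (f : K[X]) {N : ℕ} (hN : f.natDegree < N) :
    binomialComul K f =
      ∑ k ∈ Finset.range N, (Polynomial.X ^ k : K[X]) ⊗ₜ[K] Polynomial.hasseDeriv k f := by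
  have hX (n : ℕ) (hn : n < N) : binomialComul K (Polynomial.X ^ n) =
      ∑ k ∈ Finset.range N,
        (Polynomial.X ^ k : K[X]) ⊗ₜ[K] Polynomial.hasseDeriv k (Polynomial.X ^ n : K[X]) := by
    rw [binomialComul_X_pow]
    have hd (k : ℕ) : Polynomial.hasseDeriv k (Polynomial.X ^ n : K[X]) =
        (n.choose k : K) • (Polynomial.X ^ (n - k) : K[X]) := by
      rw [← Polynomial.monomial_one_right_eq_X_pow, Polynomial.hasseDeriv_monomial,
        ← Polynomial.monomial_one_right_eq_X_pow, Polynomial.smul_monomial]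
      simp
    simp only [hd, TensorProduct.tmul_smul]
    refine Finset.sum_subset (Finset.range_mono hn) fun k _ hk => ?_
    rw [Nat.choose_eq_zero_of_lt (by simpa using hk)]
    simp
  conv_lhs => rw [f.as_sum_range' N hN]
  conv_rhs => rw [f.as_sum_range' N hN]
  simp only [map_sum, TensorProduct.tmul_sum]
  rw [Finset.sum_comm]
  refine Finset.sum_congr rfl fun n hn => ?_
  rw [← Polynomial.smul_X_eq_monomial, map_smul, hX n (Finset.mem_range.mp hn), Finset.smul_sum]
  simp only [map_smul, TensorProduct.tmul_smul]

theorem derivative_hasseDeriv (k : ℕ) (f : K[X]) :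
    Polynomial.derivative (Polynomial.hasseDeriv k f) =
      ((k : K) + 1) • Polynomial.hasseDeriv (k + 1) f := by
  have h := congrArg (fun φ => φ f) (Polynomial.hasseDeriv_comp (R := K) 1 k)
  simp only [Polynomial.hasseDeriv_one, LinearMap.comp_apply, LinearMap.smul_apply] at h
  rw [h, add_comm 1 k, Nat.choose_one_right, ← Nat.cast_smul_eq_nsmul K]
  simp

theorem polynomialDerivative_surjective [CharZero K] :
    Function.Surjective (Polynomial.derivative : K[X] →ₗ[K] K[X]) := by
  intro f
  induction f using Polynomial.induction_on' with
  | add p q hp hq =>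
    obtain ⟨a, rfl⟩ := hp
    obtain ⟨b, rfl⟩ := hq
    exact ⟨a + b, map_add _ _ _⟩
  | monomial n a =>
    refine ⟨Polynomial.monomial (n + 1) (a / (n + 1)), ?_⟩
    have : (n : K) + 1 ≠ 0 := by exact_mod_cast n.succ_ne_zero
    rw [Polynomial.derivative_monomial]
    simp [this]

/-- Over all of `K[y]`, the relation `D L = L D + [y¹] L` propagates to all divided powers of `D`.
For `k = 0` the conclusion says that `L f` has no constant term. -/
theorem hasseDeriv_of_cocycleDefect_eq_zero [CharZero K] {L : K[X] →ₗ[K] K[X]}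
    (hT : ∀ f, cocycleDefect L f = 0) (k : ℕ) (f : K[X]) :
    Polynomial.hasseDeriv k (L f) =
      L (Polynomial.hasseDeriv k f) + Polynomial.C ((L f).coeff k) := by
  have hD (f : K[X]) : Polynomial.derivative (L f) =
      L (Polynomial.derivative f) + Polynomial.C ((L f).coeff 1) := by
    have := hT f
    rw [cocycleDefect_apply] at this
    linear_combination this
  induction k with
  | zero =>
    obtain ⟨F, rfl⟩ := polynomialDerivative_surjective f
    have h := congrArg (fun p => Polynomial.coeff p 0) (hD F)
    simp only [Polynomial.coeff_derivative, Polynomial.coeff_add, Polynomial.coeff_C_zero] at h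
    have h0 : (L (Polynomial.derivative F)).coeff 0 = 0 := by
      simpa using h
    simp [h0]
  | succ k ih =>
    have hk : (k : K) + 1 ≠ 0 := by exact_mod_cast k.succ_ne_zero
    have h := derivative_hasseDeriv k (L f)
    rw [ih, map_add, hD, derivative_hasseDeriv, Polynomial.derivative_C, add_zero, map_smul] at h
    -- The linear coefficient of `L (Dᵏ f / k!)` is that of `Dᵏ (L f) / k!`, by the case `k`.
    have hc : (L (Polynomial.hasseDeriv k f)).coeff 1 = ((k : K) + 1) * (L f).coeff (k + 1) := by
      have := congrArg (fun p => Polynomial.coeff p 1) ih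
      simp only [Polynomial.hasseDeriv_coeff, Polynomial.coeff_add, Polynomial.coeff_C_succ] at this
      rw [add_comm 1 k, Nat.choose_succ_self_right] at this
      simpa using this.symm
    apply smul_right_injective K[X] hk
    simp only [smul_add]
    rw [← h, hc, Polynomial.smul_C, smul_eq_mul]

theorem isBinomialOneCocycle_iff [CharZero K] (L : K[X] →ₗ[K] K[X]) :
    IsBinomialOneCocycle L ↔ ∀ f, cocycleDefect L f = 0 := by
  -- A truncation order large enough for both `f` and `L f`.
  have hN (f : K[X]) : ∃ N, f.natDegree < N ∧ (L f).natDegree < N ∧ 1 < N :=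
    ⟨f.natDegree + (L f).natDegree + 2, by omega, by omega, by omega⟩
  constructor
  · intro h f
    obtain ⟨N, hf, hLf, hN1⟩ := hN f
    -- Extract the factor of `y¹` in the first tensor component.
    have h1 := congrArg (fun φ => TensorProduct.lid K K[X]
      (LinearMap.rTensor K[X] (Polynomial.lcoeff K 1) (φ f))) h
    simp only [LinearMap.comp_apply, LinearMap.add_apply, binomialComul_eq_sum_hasseDeriv f hf,
      binomialComul_eq_sum_hasseDeriv (L f) hLf, map_sum, map_add,
      LinearMap.lTensor_tmul, LinearMap.rTensor_tmul, LinearMap.flip_apply,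
      TensorProduct.mk_apply, TensorProduct.lid_tmul, Polynomial.lcoeff_apply,
      Polynomial.coeff_X_pow, ite_smul, one_smul, zero_smul] at h1
    rw [Finset.sum_ite_eq, Finset.sum_ite_eq, if_pos (Finset.mem_range.mpr hN1),
      if_pos (Finset.mem_range.mpr hN1), Polynomial.hasseDeriv_one, Polynomial.smul_eq_C_mul, mul_one] at h1
    rw [cocycleDefect_apply, h1]
    ring
  · intro hT
    refine LinearMap.ext fun f => ?_
    obtain ⟨N, hf, hLf, -⟩ := hN f
    simp only [LinearMap.comp_apply, LinearMap.add_apply, binomialComul_eq_sum_hasseDeriv f hf,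
      binomialComul_eq_sum_hasseDeriv (L f) hLf, map_sum,
      LinearMap.lTensor_tmul, LinearMap.flip_apply, TensorProduct.mk_apply,
      hasseDeriv_of_cocycleDefect_eq_zero hT, TensorProduct.tmul_add, Finset.sum_add_distrib]
    congr 1
    refine Eq.trans ?_ (congrArg (· ⊗ₜ[K] (1 : K[X])) ((L f).as_sum_range' N hLf).symm)
    rw [TensorProduct.sum_tmul]
    refine Finset.sum_congr rfl fun k _ => ?_
    rw [← Polynomial.smul_X_eq_monomial, TensorProduct.smul_tmul, Polynomial.smul_eq_C_mul, mul_one]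

end Cocycle

/-! ### The defect of the renormalization group equation -/

section RGE

variable {K : Type*} [Field K]

/-- The difference of the two sides of the renormalization group equation. -/
noncomputable def rgeDefect (G : K[X]⟦X⟧) : K[X]⟦X⟧ :=
  mapCoeff Polynomial.derivative G -
    PowerSeries.map Polynomial.C (yCoeff 1 G) *
      (1 + (2 * PowerSeries.X * PowerSeries.derivative K[X] G - G))

theorem satisfiesRGE_iff (G : K[X]⟦X⟧) : SatisfiesRGE G ↔ rgeDefect G = 0 :=
  sub_eq_zero.symm

/-- The right-hand side `R` of the renormalization group equation always satisfies
`R = x L(P² R) + g₁`, whereas `∂G/∂y` satisfies this equation up to the term `x T(P)`. -/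
theorem X_mul_mapCoeff_cocycleDefect {L : K[X] →ₗ[K] K[X]} {G P : K[X]⟦X⟧}
    (hP : (1 - G) * P = 1) (hG : G = PowerSeries.X * mapCoeff L P) :
    PowerSeries.X * mapCoeff (cocycleDefect L) P =
      rgeDefect G - PowerSeries.X * mapCoeff L (P ^ 2 * rgeDefect G) := by
  set g := PowerSeries.map Polynomial.C (yCoeff 1 G) with hg
  have hgL : g = PowerSeries.X *
      mapCoeff (Polynomial.monomial 0 ∘ₗ Polynomial.lcoeff K 1 ∘ₗ L) P := by
    rw [hg]
    ext1 n
    rw [PowerSeries.coeff_map, yCoeff, PowerSeries.coeff_mk, hG]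
    cases n with
    | zero => simp
    | succ n => simp [PowerSeries.coeff_succ_X_mul]
  have hDG : mapCoeff Polynomial.derivative G =
      PowerSeries.X * mapCoeff Polynomial.derivative (mapCoeff L P) := by
    conv_lhs => rw [hG]
    rw [mapCoeff_X_mul]
  have hT : mapCoeff (cocycleDefect L) P = mapCoeff Polynomial.derivative (mapCoeff L P) -
      mapCoeff L (P ^ 2 * mapCoeff Polynomial.derivative G) -
        mapCoeff (Polynomial.monomial 0 ∘ₗ Polynomial.lcoeff K 1 ∘ₗ L) P := by
    rw [← mapCoeff_polynomialDerivative_inverse hP]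
    ext1 n
    simp [cocycleDefect]
  have hxG : PowerSeries.derivative K[X] G =
      mapCoeff L P + PowerSeries.X * PowerSeries.derivative K[X] (mapCoeff L P) := by
    conv_lhs => rw [hG]
    rw [powerSeriesDerivative_mul, PowerSeries.derivative_X]
    ring
  have hLR : mapCoeff L
      (P ^ 2 * (g * (1 + (2 * PowerSeries.X * PowerSeries.derivative K[X] G - G)))) =
      g * (mapCoeff L P +
        (PowerSeries.X * PowerSeries.derivative K[X] (mapCoeff L P) +
          PowerSeries.X * PowerSeries.derivative K[X] (mapCoeff L P))) := by
    have : P ^ 2 * (g * (1 + (2 * PowerSeries.X * PowerSeries.derivative K[X] G - G))) =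
        g * (P + (PowerSeries.X * PowerSeries.derivative K[X] P +
          PowerSeries.X * PowerSeries.derivative K[X] P)) := by
      rw [powerSeriesDerivative_inverse hP]
      linear_combination g * P * hP
    rw [this, hg, mapCoeff_map_C_mul, mapCoeff_add, mapCoeff_add, mapCoeff_X_mul,
      mapCoeff_derivative]
  rw [rgeDefect, ← hg, mul_sub (P ^ 2), mapCoeff_sub, hLR, hT]
  linear_combination (-1 : K[X]⟦X⟧) * hDG + hgL - g * hG + 2 * PowerSeries.X * g * hxG

/-- The fixed-point equation `V = x L(Q V)` has only the zero solution, since its right-hand side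
involves strictly lower `x`-coefficients of `V`. -/
theorem eq_zero_of_eq_X_mul_mapCoeff {L : K[X] →ₗ[K] K[X]} {Q V : K[X]⟦X⟧}
    (hV : V = PowerSeries.X * mapCoeff L (Q * V)) : V = 0 := by
  ext1 n
  induction n using Nat.strong_induction_on with
  | _ n ih =>
    rw [hV, map_zero]
    cases n with
    | zero => simp
    | succ n =>
      rw [PowerSeries.coeff_succ_X_mul, coeff_mapCoeff, PowerSeries.coeff_mul,
        Finset.sum_eq_zero, map_zero]
      intro ij hij
      rw [ih ij.2 (by have := Finset.HasAntidiagonal.mem_antidiagonal.mp hij; omega), map_zero, mul_zero]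

/-! ### Degrees of the coefficients of `1 / (1 - G)` -/

/-- The equation `∂P/∂y = g (P + 2 x ∂P/∂x)` with `g = c x + ⋯`, `c ≠ 0`, forces the `n`-th
`x`-coefficient of `P` to have degree exactly `n` in `y`: its top coefficient is
`(2 n - 1) c / n` times the preceding one. -/
theorem coeff_of_derivative_eq [CharZero K] {P : K[X]⟦X⟧} {g : K⟦X⟧}
    (hg0 : PowerSeries.coeff 0 g = 0) (hg1 : PowerSeries.coeff 1 g ≠ 0)
    (hP0 : PowerSeries.coeff 0 P = 1)
    (hP : mapCoeff Polynomial.derivative P = PowerSeries.map Polynomial.C g *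
      (P + 2 * (PowerSeries.X * PowerSeries.derivative K[X] P))) (n : ℕ) :
    (∀ m, n < m → (PowerSeries.coeff n P).coeff m = 0) ∧ (PowerSeries.coeff n P).coeff n ≠ 0 := by
  have hterm (j : ℕ) : PowerSeries.coeff j
      (P + 2 * (PowerSeries.X * PowerSeries.derivative K[X] P)) =
        Polynomial.C (2 * (j : K) + 1) * PowerSeries.coeff j P := by
    rw [two_mul, map_add, map_add]
    cases j with
    | zero => simp
    | succ j =>
      rw [PowerSeries.coeff_succ_X_mul, PowerSeries.coeff_derivative]
      simp only [map_add, map_mul, map_natCast, map_one, map_ofNat, Nat.cast_add, Nat.cast_one]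
      ring
  have hrec (n m : ℕ) : (PowerSeries.coeff n P).coeff (m + 1) * ((m : K) + 1) =
      ∑ ij ∈ Finset.HasAntidiagonal.antidiagonal n, PowerSeries.coeff ij.1 g *
        ((2 * (ij.2 : K) + 1) * (PowerSeries.coeff ij.2 P).coeff m) := by
    have h := congrArg (fun A => (PowerSeries.coeff n A).coeff m) hP
    simpa only [coeff_mapCoeff, Polynomial.coeff_derivative, PowerSeries.coeff_mul, hterm,
      PowerSeries.coeff_map, Polynomial.finsetSum_coeff, Polynomial.coeff_C_mul] using h
  induction n using Nat.strong_induction_on with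
  | _ n ih =>
    cases n with
    | zero =>
      rw [hP0]
      exact ⟨fun m hm => by rw [Polynomial.coeff_one, if_neg hm.ne'], by simp⟩
    | succ n =>
      constructor
      · intro m hm
        obtain ⟨m, rfl⟩ := Nat.exists_eq_succ_of_ne_zero (by omega : m ≠ 0)
        have hm0 : (m : K) + 1 ≠ 0 := by exact_mod_cast m.succ_ne_zero
        have h := hrec (n + 1) m
        rw [Finset.sum_eq_zero] at h
        · exact (mul_eq_zero.mp h).resolve_right hm0
        rintro ⟨i, j⟩ hij
        have hij := Finset.HasAntidiagonal.mem_antidiagonal.mp hij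
        dsimp only at hij ⊢
        rcases i with _ | i
        · rw [hg0, zero_mul]
        · rw [(ih j (by omega)).1 m (by omega), mul_zero, mul_zero]
      · have h := hrec (n + 1) n
        rw [Finset.sum_eq_single (1, n)] at h
        · intro h0
          rw [h0, zero_mul] at h
          have h2 : 2 * (n : K) + 1 ≠ 0 := by exact_mod_cast (2 * n).succ_ne_zero
          exact mul_ne_zero hg1 (mul_ne_zero h2 (ih n (by omega)).2) h.symm
        · rintro ⟨i, j⟩ hij hne
          have hij := Finset.HasAntidiagonal.mem_antidiagonal.mp hij
          dsimp only at hij ⊢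
          rcases i with _ | i
          · rw [hg0, zero_mul]
          · have hi : i ≠ 0 := by
              rintro rfl
              exact hne (by simp; omega)
            rw [(ih j (by omega)).1 n (by omega), mul_zero, mul_zero]
        · intro hnot
          exact absurd (Finset.HasAntidiagonal.mem_antidiagonal.mpr (by simp [add_comm])) hnot

/-- A linear map vanishing on one polynomial of each degree is zero. -/
theorem eq_zero_of_vanishing_on_degrees {T : K[X] →ₗ[K] K[X]} {p : ℕ → K[X]}
    (hp : ∀ n, (p n).degree = n) (hT : ∀ n, T (p n) = 0) : T = 0 := by
  let S : Polynomial.Sequence K := ⟨p, hp⟩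
  refine LinearMap.ext_on_range
    (S.span fun i => (Polynomial.leadingCoeff_ne_zero.mpr (S.ne_zero i)).isUnit) hT

end RGE

theorem theorem6p1 {K : Type*} [Field K] [CharZero K] (L : K[X] →ₗ[K] K[X])
    (hL : ∀ n : ℕ, (L (Polynomial.X ^ n)).natDegree ≤ n + 1)
    (G : K[X]⟦X⟧) (hG : IsTreeLikeSolution L G) :
    (IsBinomialOneCocycle L → SatisfiesRGE G) ∧
      ((L 1).coeff 1 ≠ 0 → (SatisfiesRGE G ↔ IsBinomialOneCocycle L)) := by
  obtain ⟨P, hP, hG⟩ := hG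
  have key := X_mul_mapCoeff_cocycleDefect hP hG
  have ha : IsBinomialOneCocycle L → SatisfiesRGE G := by
    intro hc
    rw [isBinomialOneCocycle_iff] at hc
    rw [satisfiesRGE_iff]
    have h0 : mapCoeff (cocycleDefect L) P = 0 := by
      ext1 n
      simp [hc]
    rw [h0, mul_zero] at key
    exact eq_zero_of_eq_X_mul_mapCoeff (sub_eq_zero.mp key.symm)
  refine ⟨ha, fun h1 => ⟨fun hR => ?_, ha⟩⟩
  have hG0 : PowerSeries.coeff 0 G = 0 := by
    rw [hG]
    simp
  have hP0 : PowerSeries.coeff 0 P = 1 := by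
    have h := congrArg (PowerSeries.coeff 0) hP
    simpa [PowerSeries.coeff_mul, hG0] using h
  have hG1 : PowerSeries.coeff 1 G = L 1 := by
    rw [hG, PowerSeries.coeff_succ_X_mul, coeff_mapCoeff, hP0]
  have hDP : mapCoeff Polynomial.derivative P = PowerSeries.map Polynomial.C (yCoeff 1 G) *
      (P + 2 * (PowerSeries.X * PowerSeries.derivative K[X] P)) := by
    rw [mapCoeff_polynomialDerivative_inverse hP, powerSeriesDerivative_inverse hP, hR]
    linear_combination PowerSeries.map Polynomial.C (yCoeff 1 G) * P * hP
  have hdeg := coeff_of_derivative_eq (by simp [yCoeff, hG0]) (by simpa [yCoeff, hG1] using h1)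
    hP0 hDP
  rw [satisfiesRGE_iff] at hR
  have h0 : mapCoeff (cocycleDefect L) P = 0 := by
    ext1 n
    have h := congrArg (PowerSeries.coeff (n + 1)) key
    rw [hR, mul_zero, PowerSeries.coeff_succ_X_mul, zero_sub, map_neg,
      PowerSeries.coeff_succ_X_mul, coeff_mapCoeff L, map_zero, map_zero, neg_zero] at h
    rw [h, map_zero]
  have hT : cocycleDefect L = 0 := by
    refine eq_zero_of_vanishing_on_degrees (p := fun n => PowerSeries.coeff n P) (fun n => ?_)
      fun n => ?_
    · refine Polynomial.degree_eq_of_le_of_coeff_ne_zero ?_ (hdeg n).2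
      exact (Polynomial.degree_le_iff_coeff_zero _ _).mpr fun m hm =>
        (hdeg n).1 m (by exact_mod_cast hm)
    · have h := congrArg (PowerSeries.coeff n) h0
      simpa using h
  rw [isBinomialOneCocycle_iff, hT]
  simp
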